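/- Let $n,m,q\ge 0$ and $N\ge 1$ be integers, let $H\in\mathbb R^{mN\times mN}$ be symmetric positive definite, $F\in\mathbb R^{mN\times n}$, $G\in\mathbb R^{q\times mN}$, $E\in\mathbb R^{q\times n}$, $d\in\mathbb R^q$, and consider the parametric quadratic program $$U^*(x)=\arg\min_{U\in\mathbb R^{mN}}\ \tfrac12 U^\top HU+x^\top F^\top U\quad\text{s.t.}\quad GU\le Ex+d .$$ Let $\mathcal F_{\rm MPC}$ be the set of $x\in\mathbb R^n$ for which it is feasible, and let $f_{\rm MPC}(x)=S\,U^*(x)\in\mathbb R^m$, where $S=(I\ 0\ \dots\ 0)$ selects the first $m$ entries. Let $\overline\lambda,\overline r\in\mathbb R^q$ be upper bounds for the dual optimizers and the residuals: for every $x\in\mathcal F_{\rm MPC}$ the residual $r^*(x)=Ex+d-GU^*(x)$ satisfies $r^*(x)\le\overline r$, and if $x$ has a Karush-Kuhn-Tucker multiplier, then it has one that is $\le\overline\lambda$. For $\delta\in\{0,1\}^q$ write $\mathcal E(\delta)$ for the set of all $(x,U,\lambda,r)$ with $$HU+Fx+G^\top\lambda=0,\quad r=Ex+d-GU,\quad 0\le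 r\le\operatorname{diag}(\overline r)(\mathbf 1-\delta),\quad 0\le\lambda\le\operatorname{diag}(\overline\lambda)\,\delta ,$$ and let $\mathcal R_\delta$ be the set of all $x$ that occur in $\mathcal E(\delta)$, i.e. the region of the active set $\{k:\delta_k=1\}$. A matrix $K\in\mathbb R^{m\times n}$ is a local gain on $\mathcal R_\delta$ if for some $b\in\mathbb R^m$ we have $f_{\rm MPC}(x)=Kx+b$ for all $x\in\mathcal R_\delta$. A set is full-dimensional if it has non-empty interior. Assume that $\mathcal F_{\rm MPC}$ is full-dimensional, let $i\in\{1,\dots,q\}$, and consider the MILP $$\max\ \sum_{j=1}^m\bigl(U^{(j)}_j-U^*_j\bigr)\quad\text{s.t.}\quad \delta\in\{0,1\}^q,\ \delta_i=1,\ (x,U^*,\lambda^*,r^*)\in\mathcal E(\delta),\ (x^{(j)},U^{(j)},\lambda^{(j)},r^{(j)})\in\mathcal E(\delta)\ \ (j=1,\dots,m).$$ If this MILP is feasible with optimal value $0$, then constraint $i$ can be omitted when computing the minimum Lipschitz constant of $f_{\rm MPC}$, in the following sense. 1. For every $\delta\in\{0,1\}^q$ with $\delta_i=1$, either $K=0$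 is the one and only local gain on $\mathcal R_\delta$, or $\mathcal R_\delta$ is not full-dimensional. 2. For every $p\in[1,\infty]$, $f_{\rm MPC}$ has a smallest Lipschitz constant $L_p^*\ge 0$ on $\mathcal F_{\rm MPC}$ with respect to the $p$-norms, and, with $\|\cdot\|_p$ the induced matrix norm, $$L_p^*=\max_{\delta}\ \|K_\delta\|_p=\max_{\delta:\ \delta_i=0}\ \|K_\delta\|_p ,$$ where $\delta$ ranges over the vectors in $\{0,1\}^q$ with full-dimensional $\mathcal R_\delta$, $K_\delta$ is the local gain on $\mathcal R_\delta$, and the second maximum is read as $0$ if no such $\delta$ with $\delta_i=0$ exists. -/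

import Mathlib

open Matrix
open scoped ENNReal

noncomputable section

namespace MPC

/-- Data of the condensed parametric QP
`min_U ½ Uᵀ H U + xᵀ Fᵀ U` subject to `G U ≤ E x + d`,
with state dimension `n`, input dimension `m`, horizon `N` and `q` constraints. The entry
`U (k, j)` is the `j`-th component of the predicted input `u(k)`. -/
structure ParametricQP (n m N q : ℕ) where
  H : Matrix (Fin N × Fin m) (Fin N × Fin m) ℝ
  F : Matrix (Fin N × Fin m) (Fin n) ℝ
  G : Matrix (Fin q) (Fin N × Fin m) ℝ
  E : Matrix (Fin q) (Fin n) ℝ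
  d : Fin q → ℝ

namespace ParametricQP

variable {n m N q : ℕ}

def cost (D : ParametricQP n m N q) (x : Fin n → ℝ) (U : Fin N × Fin m → ℝ) : ℝ :=
  1 / 2 * (U ⬝ᵥ (D.H *ᵥ U)) + x ⬝ᵥ (D.Fᵀ *ᵥ U)

def Admissible (D : ParametricQP n m N q) (x : Fin n → ℝ) (U : Fin N × Fin m → ℝ) : Prop :=
  D.G *ᵥ U ≤ D.E *ᵥ x + D.d

/-- The set `F_MPC` of all parameters for which the QP is feasible. -/
def feasibleSet (D : ParametricQP n m N q) : Set (Fin n → ℝ) :=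
  {x | ∃ U, D.Admissible x U}

def IsOptimizer (D : ParametricQP n m N q) (x : Fin n → ℝ) (U : Fin N × Fin m → ℝ) : Prop :=
  D.Admissible x U ∧ ∀ V, D.Admissible x V → D.cost x U ≤ D.cost x V

open Classical in
/-- The optimizer `U*(x)`; for `H` positive definite and `x` in the feasible set it exists and is
unique. The value `0` elsewhere is never used. -/
def optimizer (D : ParametricQP n m N q) (x : Fin n → ℝ) : Fin N × Fin m → ℝ :=
  if h : ∃ U, D.IsOptimizer x U then h.choose else 0

/-- The selection matrix `S = (I 0 … 0)`. -/
def selection (m N : ℕ) [NeZero N] : Matrix (Fin m) (Fin N × Fin m) ℝ :=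
  Matrix.of fun j kl => if kl = (0, j) then 1 else 0

/-- The control law `f_MPC(x) = S U*(x)`. -/
def controlLaw [NeZero N] (D : ParametricQP n m N q) (x : Fin n → ℝ) : Fin m → ℝ :=
  selection m N *ᵥ D.optimizer x

/-- Stationarity `H U + F x + Gᵀ λ = 0` and the definition `r = E x + d - G U` of the residual. -/
def Stationary (D : ParametricQP n m N q) (x : Fin n → ℝ) (U : Fin N × Fin m → ℝ)
    (lam r : Fin q → ℝ) : Prop :=
  D.H *ᵥ U + D.F *ᵥ x + D.Gᵀ *ᵥ lam = 0 ∧ r = D.E *ᵥ x + D.d - D.G *ᵥ U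

/-- The Karush-Kuhn-Tucker conditions of the QP. -/
def IsKKT (D : ParametricQP n m N q) (x : Fin n → ℝ) (U : Fin N × Fin m → ℝ)
    (lam r : Fin q → ℝ) : Prop :=
  D.Stationary x U lam r ∧ 0 ≤ r ∧ 0 ≤ lam ∧ ∀ k, lam k * r k = 0

/-- `lamBar` and `rBar` are upper bounds for dual optimizers and residuals over the feasible set.
Dual optimizers need not be unique (the set of them is unbounded as soon as a constraint with
a zero row in `G` is active), so the bound asks for one of them below `lamBar`. -/
def AreBounds (D : ParametricQP n m N q) (lamBar rBar : Fin q → ℝ) : Prop :=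
  ∀ x ∈ D.feasibleSet, ∀ U lam r, D.IsKKT x U lam r →
    r ≤ rBar ∧ ∃ lam', D.IsKKT x U lam' r ∧ lam' ≤ lamBar

def IsBinary (δ : Fin q → ℝ) : Prop := ∀ k, δ k = 0 ∨ δ k = 1

/-- The constraints of the mixed-integer encoding of the KKT conditions, for a given vector `δ`. -/
def Encoding (D : ParametricQP n m N q) (lamBar rBar δ : Fin q → ℝ) (x : Fin n → ℝ)
    (U : Fin N × Fin m → ℝ) (lam r : Fin q → ℝ) : Prop :=
  D.Stationary x U lam r ∧
  (∀ k, 0 ≤ r k ∧ r k ≤ rBar k * (1 - δ k)) ∧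
  (∀ k, 0 ≤ lam k ∧ lam k ≤ lamBar k * δ k)

/-- The set of objective values of the feasible points of the MILP associated with the
constraint `i`: a point `(x, U, lam, r, δ)` of the encoding with `δ i = 1`, and `m` further
points `(x', U', lam', r')`, indexed by `j`, of the encoding with the same `δ`. -/
def milpValues [NeZero N] (D : ParametricQP n m N q) (lamBar rBar : Fin q → ℝ) (i : Fin q) :
    Set ℝ :=
  {v | ∃ (δ : Fin q → ℝ) (x : Fin n → ℝ) (U : Fin N × Fin m → ℝ) (lam r : Fin q → ℝ)
      (x' : Fin m → Fin n → ℝ) (U' : Fin m → Fin N × Fin m → ℝ) (lam' r' : Fin m → Fin q → ℝ),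
    IsBinary δ ∧ δ i = 1 ∧ D.Encoding lamBar rBar δ x U lam r ∧
    (∀ j, D.Encoding lamBar rBar δ (x' j) (U' j) (lam' j) (r' j)) ∧
    v = ∑ j, (U' j (0, j) - U (0, j))}

/-- The region of the active set `{k | δ k = 1}`: all parameters at which this
choice of `δ` solves the encoding. -/
def region (D : ParametricQP n m N q) (lamBar rBar δ : Fin q → ℝ) : Set (Fin n → ℝ) :=
  {x | ∃ U lam r, D.Encoding lamBar rBar δ x U lam r}

/-- `K` is a gain of the control law on `R`: `f_MPC(x) = K x + b` on `R` for some `b`. -/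
def IsGainOn [NeZero N] (D : ParametricQP n m N q) (R : Set (Fin n → ℝ))
    (K : Matrix (Fin m) (Fin n) ℝ) : Prop :=
  ∃ b : Fin m → ℝ, ∀ x ∈ R, D.controlLaw x = K *ᵥ x + b

/-- The matrix norm induced by the vector `p`-norms. -/
def inducedNorm (p : ℝ≥0∞) [Fact (1 ≤ p)] (K : Matrix (Fin m) (Fin n) ℝ) : ℝ :=
  ‖LinearMap.toContinuousLinearMap (Matrix.toLpLin p p K)‖

/-- The `p`-norms of the local gains over the full-dimensional regions of those active sets
(given by binary vectors `δ`) that satisfy `P`. -/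
def gainNorms [NeZero N] (D : ParametricQP n m N q) (lamBar rBar : Fin q → ℝ) (p : ℝ≥0∞)
    [Fact (1 ≤ p)] (P : (Fin q → ℝ) → Prop) : Set ℝ :=
  {c | ∃ (δ : Fin q → ℝ) (K : Matrix (Fin m) (Fin n) ℝ), IsBinary δ ∧ P δ ∧
    (interior (D.region lamBar rBar δ)).Nonempty ∧
    D.IsGainOn (D.region lamBar rBar δ) K ∧ c = inducedNorm p K}

/-- The Lipschitz constants of the control law on the feasible set for the `p`-norms. -/
def lipschitzConstants [NeZero N] (D : ParametricQP n m N q) (p : ℝ≥0∞) [Fact (1 ≤ p)] : Set ℝ :=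
  {L | 0 ≤ L ∧ ∀ x ∈ D.feasibleSet, ∀ y ∈ D.feasibleSet,
    ‖WithLp.toLp p (D.controlLaw x - D.controlLaw y)‖ ≤ L * ‖WithLp.toLp p (x - y)‖}

end ParametricQP

end MPC

end

/-! Since `H` is positive definite, each feasible parameter has a unique optimizer, characterised by
the KKT conditions (`IsOptimizer.exists_isKKT`, `IsKKT.optimizer_eq`). The bounds let each parameter
be encoded by some binary `δ`, so finitely many regions cover the feasible set. Each region is
closed, and the control law is affine on it (`exists_linearMap_encoding`), even when multipliers are
not unique.

The feasible set is convex with interior points, so the full-dimensional regions already cover it.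
Following a segment from region to region shows that the largest gain norm is a Lipschitz constant
(`norm_sub_le_of_finite_closed_cover`); small steps inside a region show that none is smaller.

A nonpositive MILP value makes the control law constant on every region with `δ i = 1`. These have
gain `0` when full-dimensional and cannot raise the maximum above the other regions and `0`. -/

/-! ### Farkas' lemma and coercivity -/

/-- **Farkas' lemma**: a linear functional that is nonpositive wherever finitely many functionals
are nonpositive is a conic combination of them. -/
theorem exists_nonneg_sum_of_forall_nonpos {V ι : Type*} [AddCommGroup V] [Module ℝ V]
    (s : Finset ι) (a : ι → V →ₗ[ℝ] ℝ) (b : V →ₗ[ℝ] ℝ)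
    (h : ∀ v, (∀ j ∈ s, a j v ≤ 0) → b v ≤ 0) :
    ∃ c : ι → ℝ, (∀ j, 0 ≤ c j) ∧ b = ∑ j ∈ s, c j • a j := by
  classical
  induction s using Finset.induction_on generalizing a b with
  | empty =>
    refine ⟨0, fun _ => le_rfl, ?_⟩
    ext v
    have h1 := h v (by simp)
    have h2 := h (-v) (by simp)
    rw [map_neg] at h2
    simp only [Finset.sum_empty, LinearMap.zero_apply]
    linarith
  | insert k s hk ih =>
    by_cases hb : ∀ v, (∀ j ∈ s, a j v ≤ 0) → b v ≤ 0
    · obtain ⟨c, hc, hbc⟩ := ih a b hb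
      refine ⟨Function.update c k 0, fun j => ?_, ?_⟩
      · by_cases hj : j = k
        · subst hj; simp
        · simpa [Function.update_of_ne hj] using hc j
      · rw [Finset.sum_insert hk, hbc]
        simp only [Function.update_self, zero_smul, zero_add]
        exact Finset.sum_congr rfl fun j hj => by
          rw [Function.update_of_ne (ne_of_mem_of_not_mem hj hk)]
    · push Not at hb
      obtain ⟨w, hw, hbw⟩ := hb
      have hkw : 0 < a k w := by
        by_contra hcon
        push Not at hcon
        have := h w (fun j hj => by
          rcases Finset.mem_insert.1 hj with rfl | hj
          · exact hcon
          · exact hw j hj)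
        linarith
      -- `P` projects onto the kernel of `a k` along `w`: constraint `k` holds with equality at `P
      -- v`, so the induction hypothesis applies to the functionals composed with `P`.
      let P : V →ₗ[ℝ] V := LinearMap.id - (a k).smulRight ((a k w)⁻¹ • w)
      have hP : ∀ v, P v = v - (a k v * (a k w)⁻¹) • w := fun v => by
        simp [P, smul_smul]
      obtain ⟨c, hc, hbc⟩ := ih (fun j => (a j).comp P) (b.comp P) (fun v hv => by
        refine h (P v) fun j hj => ?_
        rcases Finset.mem_insert.1 hj with rfl | hj
        · rw [hP, map_sub, map_smul, smul_eq_mul, mul_assoc, inv_mul_cancel₀ hkw.ne']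
          simp
        · exact hv j hj)
      have hsum : 0 ≤ b w - ∑ j ∈ s, c j * a j w := by
        have : ∑ j ∈ s, c j * a j w ≤ 0 :=
          Finset.sum_nonpos fun j hj => mul_nonpos_of_nonneg_of_nonpos (hc j) (hw j hj)
        linarith
      -- `b - ∑ c j • a j` vanishes on the kernel of `a k`, so it is a multiple of `a k`; its value
      -- at `w` gives the factor.
      refine ⟨Function.update c k ((a k w)⁻¹ * (b w - ∑ j ∈ s, c j * a j w)), fun j => ?_, ?_⟩
      · by_cases hj : j = k
        · subst hj
          rw [Function.update_self]
          positivity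
        · simpa [Function.update_of_ne hj] using hc j
      · have hupd : ∀ t : ℝ, ∑ j ∈ s, Function.update c k t j • a j = ∑ j ∈ s, c j • a j :=
          fun t => Finset.sum_congr rfl fun j hj => by
            rw [Function.update_of_ne (ne_of_mem_of_not_mem hj hk)]
        rw [Finset.sum_insert hk, Function.update_self, hupd]
        ext v
        have := LinearMap.congr_fun hbc v
        simp only [LinearMap.comp_apply, hP, map_sub, map_smul, smul_eq_mul,
          LinearMap.sum_apply, LinearMap.smul_apply, mul_sub, Finset.sum_sub_distrib] at this
        simp only [LinearMap.add_apply, LinearMap.sum_apply, LinearMap.smul_apply, smul_eq_mul]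
        have e : ∑ j ∈ s, c j * (a k v * (a k w)⁻¹ * a j w)
            = a k v * (a k w)⁻¹ * ∑ j ∈ s, c j * a j w := by
          rw [Finset.mul_sum]
          exact Finset.sum_congr rfl fun j _ => by ring
        rw [e] at this
        linear_combination this

/-- A positive definite quadratic form dominates a multiple of the squared norm. -/
theorem Matrix.PosDef.exists_mul_sq_norm_le {ι : Type*} [Fintype ι] {H : Matrix ι ι ℝ}
    (hH : H.PosDef) : ∃ c : ℝ, 0 < c ∧ ∀ v : ι → ℝ, c * ‖v‖ ^ 2 ≤ v ⬝ᵥ (H *ᵥ v) := by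
  have hcont : Continuous fun v : ι → ℝ => v ⬝ᵥ (H *ᵥ v) := by fun_prop
  rcases (Metric.sphere (0 : ι → ℝ) 1).eq_empty_or_nonempty with he | hne
  · refine ⟨1, one_pos, fun v => ?_⟩
    have hv : v = 0 := by
      by_contra hv
      have : (‖v‖⁻¹ • v) ∈ Metric.sphere (0 : ι → ℝ) 1 := by
        simp [norm_smul, hv]
      simp [he] at this
    simp [hv]
  · obtain ⟨w, hw, hmin⟩ := (isCompact_sphere (0 : ι → ℝ) 1).exists_isMinOn hne hcont.continuousOn
    have hw0 : w ≠ 0 := by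
      rintro rfl
      simp at hw
    refine ⟨w ⬝ᵥ (H *ᵥ w), by simpa using hH.dotProduct_mulVec_pos hw0, fun v => ?_⟩
    by_cases hv : v = 0
    · simp [hv]
    have hn : 0 < ‖v‖ := norm_pos_iff.2 hv
    have hm := hmin (show ‖v‖⁻¹ • v ∈ Metric.sphere (0 : ι → ℝ) 1 by simp [norm_smul, hv])
    simp only [Set.mem_ofPred_eq, Matrix.mulVec_smul, dotProduct_smul, smul_dotProduct,
      smul_eq_mul] at hm
    calc w ⬝ᵥ H *ᵥ w * ‖v‖ ^ 2 ≤ (‖v‖⁻¹ * (‖v‖⁻¹ * (v ⬝ᵥ H *ᵥ v))) * ‖v‖ ^ 2 := by gcongr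
      _ = v ⬝ᵥ H *ᵥ v := by field_simp

/-! ### Optimizers and the KKT conditions -/

namespace MPC.ParametricQP

variable {n m N q : ℕ} {D : ParametricQP n m N q} {x : Fin n → ℝ} {U V : Fin N × Fin m → ℝ}
  {lam r lamBar rBar δ : Fin q → ℝ}

theorem cost_add (hH : D.H.PosDef) (v : Fin N × Fin m → ℝ) :
    D.cost x (U + v) = D.cost x U + (D.H *ᵥ U + D.F *ᵥ x) ⬝ᵥ v + 1 / 2 * (v ⬝ᵥ (D.H *ᵥ v)) := by
  have hsymm : D.Hᵀ = D.H := by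
    rw [← conjTranspose_eq_transpose_of_trivial]
    exact hH.isHermitian
  have h1 : U ⬝ᵥ (D.H *ᵥ v) = v ⬝ᵥ (D.H *ᵥ U) := by
    rw [dotProduct_mulVec, ← mulVec_transpose, hsymm, dotProduct_comm]
  have h2 : x ⬝ᵥ (D.Fᵀ *ᵥ v) = v ⬝ᵥ (D.F *ᵥ x) := by
    rw [dotProduct_mulVec, vecMul_transpose, dotProduct_comm]
  simp only [cost, mulVec_add, dotProduct_add, add_dotProduct, h1, h2,
    dotProduct_comm (D.H *ᵥ U) v, dotProduct_comm (D.F *ᵥ x) v]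
  ring

theorem exists_isOptimizer (hH : D.H.PosDef) (hx : x ∈ D.feasibleSet) :
    ∃ U, D.IsOptimizer x U := by
  obtain ⟨U₀, hU₀⟩ := hx
  obtain ⟨c, hc, hcv⟩ := hH.exists_mul_sq_norm_le
  have hcont : Continuous (D.cost x) := by
    unfold cost
    fun_prop
  have hclosed : IsClosed {U | D.Admissible x U} := by
    unfold Admissible
    exact isClosed_le (by fun_prop) continuous_const
  let ℓ : (Fin N × Fin m → ℝ) →L[ℝ] ℝ :=
    LinearMap.toContinuousLinearMap ((dotProductBilin ℝ ℝ x).comp D.Fᵀ.mulVecLin)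
  have hℓ : ∀ U, -(‖ℓ‖ * ‖U‖) ≤ x ⬝ᵥ (D.Fᵀ *ᵥ U) := fun U =>
    neg_le_of_abs_le (ℓ.le_opNorm U)
  -- Quadratic growth beats the linear term, so the cost is coercive and attains its minimum on the
  -- closed admissible set.
  have hlow : ∀ U, ‖U‖ * (c / 2 * ‖U‖ - ‖ℓ‖) ≤ D.cost x U := fun U => by
    have h1 := hcv U
    have h2 := hℓ U
    unfold cost
    linarith
  have htend : Filter.Tendsto (D.cost x) (Filter.cocompact _) Filter.atTop := by
    refine Filter.tendsto_atTop_mono hlow ?_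
    have hn := tendsto_norm_cocompact_atTop (E := Fin N × Fin m → ℝ)
    refine hn.atTop_mul_atTop₀ ?_
    exact Filter.tendsto_atTop_add_const_right _ _ (hn.const_mul_atTop (by positivity))
  obtain ⟨U, hU, hmin⟩ := hcont.continuousOn.exists_isMinOn' hclosed hU₀
    ((htend.eventually_ge_atTop (D.cost x U₀)).filter_mono inf_le_left)
  exact ⟨U, hU, fun V hV => hmin hV⟩

/-- Linearly constrained optimizers have multipliers, without any constraint qualification. -/
theorem IsOptimizer.exists_isKKT (hH : D.H.PosDef) (hU : D.IsOptimizer x U) :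
    ∃ lam r, D.IsKKT x U lam r := by
  classical
  set r := D.E *ᵥ x + D.d - D.G *ᵥ U with hr
  have hr0 : 0 ≤ r := sub_nonneg.2 hU.1
  set g := D.H *ᵥ U + D.F *ᵥ x with hg
  -- Along a direction that increases no active constraint, short steps stay admissible: inactive
  -- constraints have slack. Optimality divided by the step length then gives a nonnegative slope in
  -- the limit.
  have hdir : ∀ v, (∀ k ∈ Finset.univ.filter (fun k => r k = 0), (D.G *ᵥ v) k ≤ 0) →
      -(g ⬝ᵥ v) ≤ 0 := by
    intro v hv
    have hadm : ∀ᶠ t : ℝ in nhdsWithin 0 (Set.Ioi 0), D.Admissible x (U + t • v) := by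
      have : ∀ᶠ t : ℝ in nhdsWithin 0 (Set.Ioi 0), ∀ k, t * (D.G *ᵥ v) k ≤ r k := by
        rw [Filter.eventually_all]
        intro k
        rcases (hr0 k).eq_or_lt with hk | hk
        · filter_upwards [self_mem_nhdsWithin] with t ht
          rw [← hk]
          exact mul_nonpos_of_nonneg_of_nonpos (le_of_lt ht) (hv k (by simpa using hk.symm))
        · have : Filter.Tendsto (fun t : ℝ => t * (D.G *ᵥ v) k) (nhdsWithin 0 (Set.Ioi 0))
              (nhds (0 * (D.G *ᵥ v) k)) :=
            ((continuous_id.mul continuous_const).tendsto 0).mono_left nhdsWithin_le_nhds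
          rw [zero_mul] at this
          exact (this.eventually (gt_mem_nhds hk)).mono fun t ht => le_of_lt ht
      filter_upwards [this] with t ht k
      have := ht k
      simp only [hr, Pi.sub_apply] at this
      simp only [mulVec_add, mulVec_smul, Pi.add_apply, Pi.smul_apply, smul_eq_mul] at this ⊢
      linarith
    have hineq : ∀ᶠ t : ℝ in nhdsWithin 0 (Set.Ioi 0),
        0 ≤ g ⬝ᵥ v + t * (1 / 2 * (v ⬝ᵥ (D.H *ᵥ v))) := by
      filter_upwards [hadm, self_mem_nhdsWithin] with t ht ht0
      have h1 := hU.2 _ ht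
      rw [cost_add hH, ← hg] at h1
      simp only [mulVec_smul, dotProduct_smul, smul_dotProduct, smul_eq_mul] at h1
      refine nonneg_of_mul_nonneg_right (a := t) ?_ ht0
      linarith
    have hlim : Filter.Tendsto (fun t : ℝ => g ⬝ᵥ v + t * (1 / 2 * (v ⬝ᵥ (D.H *ᵥ v))))
        (nhdsWithin 0 (Set.Ioi 0)) (nhds (g ⬝ᵥ v + 0 * (1 / 2 * (v ⬝ᵥ (D.H *ᵥ v))))) :=
      ((continuous_const.add (continuous_id.mul continuous_const)).tendsto 0).mono_left
        nhdsWithin_le_nhds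
    have := ge_of_tendsto hlim hineq
    linarith
  obtain ⟨c, hc, hbc⟩ := exists_nonneg_sum_of_forall_nonpos
    (Finset.univ.filter fun k => r k = 0)
    (fun k => (LinearMap.proj k).comp D.G.mulVecLin) (-dotProductBilin ℝ ℝ g) hdir
  refine ⟨fun k => if r k = 0 then c k else 0, r, ⟨?_, rfl⟩, hr0, fun k => ?_, fun k => ?_⟩
  · rw [← hg, ← dotProduct_eq_zero_iff]
    intro v
    have := LinearMap.congr_fun hbc v
    simp only [LinearMap.neg_apply, dotProductBilin_apply_apply, LinearMap.sum_apply,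
      LinearMap.smul_apply, LinearMap.comp_apply, mulVecLin_apply, LinearMap.proj_apply,
      smul_eq_mul] at this
    rw [Finset.sum_filter] at this
    rw [add_dotProduct, mulVec_transpose, ← dotProduct_mulVec]
    have e : (fun k => if r k = 0 then c k else 0) ⬝ᵥ D.G *ᵥ v
        = ∑ k, if r k = 0 then c k * (D.G *ᵥ v) k else 0 :=
      Finset.sum_congr rfl fun k _ => by simp
    rw [e]
    linarith
  · by_cases h : r k = 0 <;> simp [h, hc k]
  · by_cases h : r k = 0 <;> simp [h]

theorem IsKKT.admissible (h : D.IsKKT x U lam r) : D.Admissible x U := by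
  have := h.2.1
  rw [h.1.2] at this
  exact sub_nonneg.1 this

/-- By stationarity the first-order term is `-lam ⬝ᵥ G (V - U)`, nonnegative by complementarity; the
second-order term is strictly positive. -/
theorem IsKKT.cost_lt (hH : D.H.PosDef) (h : D.IsKKT x U lam r) (hV : D.Admissible x V)
    (hne : V ≠ U) : D.cost x U < D.cost x V := by
  obtain ⟨⟨hst, hr⟩, -, hlam, hcompl⟩ := h
  have hV' : V = U + (V - U) := by abel
  have hpos : 0 < (V - U) ⬝ᵥ (D.H *ᵥ (V - U)) := by
    simpa using hH.dotProduct_mulVec_pos (sub_ne_zero.2 hne)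
  have hgrad : D.H *ᵥ U + D.F *ᵥ x = -(D.Gᵀ *ᵥ lam) := eq_neg_of_add_eq_zero_left hst
  have hle : lam ⬝ᵥ (D.G *ᵥ (V - U)) ≤ 0 := by
    refine Finset.sum_nonpos fun k _ => ?_
    have h1 : (D.G *ᵥ (V - U)) k ≤ r k := by
      have := hV k
      rw [hr, mulVec_sub]
      simp only [Pi.add_apply, Pi.sub_apply] at this ⊢
      linarith
    exact (mul_le_mul_of_nonneg_left h1 (hlam k)).trans_eq (hcompl k)
  rw [hV', cost_add hH, hgrad, neg_dotProduct, mulVec_transpose, ← dotProduct_mulVec]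
  linarith

theorem IsKKT.optimizer_eq (hH : D.H.PosDef) (h : D.IsKKT x U lam r) : D.optimizer x = U := by
  have hex : ∃ U, D.IsOptimizer x U := exists_isOptimizer hH ⟨U, h.admissible⟩
  have hopt : D.IsOptimizer x (D.optimizer x) := by
    unfold optimizer
    rw [dif_pos hex]
    exact hex.choose_spec
  by_contra hne
  exact absurd (hopt.2 U h.admissible) (not_le.2 (h.cost_lt hH hopt.1 hne))

theorem Encoding.isKKT (hδ : IsBinary δ) (h : D.Encoding lamBar rBar δ x U lam r) :
    D.IsKKT x U lam r := by
  refine ⟨h.1, fun k => (h.2.1 k).1, fun k => (h.2.2 k).1, fun k => ?_⟩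
  obtain ⟨h1, h2⟩ := h.2.1 k
  obtain ⟨h3, h4⟩ := h.2.2 k
  rcases hδ k with hk | hk <;> rw [hk] at h2 h4
  · have : lam k = 0 := by linarith
    simp [this]
  · have : r k = 0 := by linarith
    simp [this]

theorem controlLaw_apply [NeZero N] (j : Fin m) : D.controlLaw x j = D.optimizer x (0, j) := by
  simp [controlLaw, selection, mulVec, dotProduct]

theorem Encoding.controlLaw_eq [NeZero N] (hH : D.H.PosDef) (hδ : IsBinary δ)
    (h : D.Encoding lamBar rBar δ x U lam r) (j : Fin m) : D.controlLaw x j = U (0, j) := by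
  rw [controlLaw_apply, (h.isKKT hδ).optimizer_eq hH]

theorem region_subset_feasibleSet (hδ : IsBinary δ) :
    D.region lamBar rBar δ ⊆ D.feasibleSet := fun _ ⟨U, _, _, h⟩ => ⟨U, (h.isKKT hδ).admissible⟩

theorem exists_mem_region (hH : D.H.PosDef) (hBounds : D.AreBounds lamBar rBar)
    (hx : x ∈ D.feasibleSet) : ∃ δ, IsBinary δ ∧ x ∈ D.region lamBar rBar δ := by
  classical
  obtain ⟨U, hU⟩ := exists_isOptimizer hH hx
  obtain ⟨lam, r, hk⟩ := hU.exists_isKKT hH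
  obtain ⟨hr, lam', hk', hlam'⟩ := hBounds x hx U lam r hk
  -- `δ` marks the support of the bounded multiplier; complementarity makes the residual vanish
  -- there.
  refine ⟨fun k => if lam' k = 0 then 0 else 1, fun k => ?_, U, lam', r, hk'.1, fun k => ?_,
    fun k => ?_⟩
  · by_cases h : lam' k = 0 <;> simp [h]
  · refine ⟨hk'.2.1 k, ?_⟩
    by_cases h : lam' k = 0
    · simpa [h] using hr k
    · have := (mul_eq_zero.1 (hk'.2.2.2 k)).resolve_left h
      simp [h, this]
  · refine ⟨hk'.2.2.1 k, ?_⟩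
    by_cases h : lam' k = 0
    · simp [h]
    · simpa [h] using hlam' k

end MPC.ParametricQP

/-! ### Linear factorization, closed covers and Lipschitz estimates -/

/-- `g` factors through the range of `f`, and over a field a map on a subspace extends to the whole
space. -/
theorem LinearMap.exists_comp_eq_of_ker_le {𝕜 M X Y : Type*} [Field 𝕜] [AddCommGroup M]
    [Module 𝕜 M] [AddCommGroup X] [Module 𝕜 X] [AddCommGroup Y] [Module 𝕜 Y] (f : M →ₗ[𝕜] X)
    (g : M →ₗ[𝕜] Y) (h : LinearMap.ker f ≤ LinearMap.ker g) :
    ∃ T : X →ₗ[𝕜] Y, ∀ z, T (f z) = g z := by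
  obtain ⟨T, hT⟩ := LinearMap.exists_extend
    (((LinearMap.ker f).liftQ g h).comp f.quotKerEquivRange.symm.toLinearMap)
  refine ⟨T, fun z => ?_⟩
  have h1 := LinearMap.congr_fun hT ⟨f z, LinearMap.mem_range_self f z⟩
  have h2 : f.quotKerEquivRange.symm ⟨f z, LinearMap.mem_range_self f z⟩
      = (LinearMap.ker f).mkQ z := by
    rw [LinearEquiv.symm_apply_eq]
    rfl
  simpa [h2] using h1

/-- Finitely many closed sets that cover a set with dense interior cover it already without those
of empty interior. -/
theorem exists_mem_of_nonempty_interior {X ι : Type*} [TopologicalSpace X] {s : Set ι}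
    (hs : s.Finite) {A : ι → Set X} (hA : ∀ i ∈ s, IsClosed (A i)) {S : Set X}
    (hcov : ∀ x ∈ S, ∃ i ∈ s, x ∈ A i) (hS : S ⊆ closure (interior S)) :
    ∀ x ∈ S, ∃ i ∈ s, (interior (A i)).Nonempty ∧ x ∈ A i := by
  set full := {i ∈ s | (interior (A i)).Nonempty} with hfull
  -- A finite union of closed sets with empty interior has empty interior, so it cannot contain the
  -- open part of `S` missed by the others.
  have hthin : ∀ t : Set ι, t.Finite → t ⊆ s \ full → interior (⋃ i ∈ t, A i) = ∅ := by
    intro t ht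
    induction t, ht using Set.Finite.induction_on with
    | empty => simp
    | @insert a t ha ht ih =>
      intro hsub
      rw [Set.biUnion_insert, interior_union_isClosed_of_interior_empty
        (hA a (hsub (Set.mem_insert a t)).1) (ih ((Set.subset_insert a t).trans hsub))]
      by_contra hne
      have hm := hsub (Set.mem_insert a t)
      exact hm.2 ⟨hm.1, Set.nonempty_iff_ne_empty.2 hne⟩
  have hclosed : IsClosed (⋃ i ∈ full, A i) :=
    (hs.subset (Set.sep_subset _ _)).isClosed_biUnion fun i hi => hA i hi.1
  have hint : interior S ⊆ ⋃ i ∈ full, A i := by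
    intro x hx
    by_contra hxn
    have hopen : IsOpen (interior S \ ⋃ i ∈ full, A i) := isOpen_interior.sdiff hclosed
    have hsub : interior S \ ⋃ i ∈ full, A i ⊆ ⋃ i ∈ s \ full, A i := by
      rintro y ⟨hy, hyn⟩
      obtain ⟨i, hi, hyi⟩ := hcov y (interior_subset hy)
      refine Set.mem_biUnion ⟨hi, fun hif => hyn (Set.mem_biUnion hif hyi)⟩ hyi
    have hmem := interior_maximal hsub hopen ⟨hx, hxn⟩
    rw [hthin _ (hs.subset Set.sdiff_subset) subset_rfl] at hmem
    exact hmem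
  intro x hx
  obtain ⟨i, hi, hxi⟩ := Set.mem_iUnion₂.1 (closure_minimal hint hclosed (hS hx))
  exact ⟨i, hi.1, hi.2, hxi⟩

/-- A map that is `C`-Lipschitz on each of finitely many closed sets covering a segment
satisfies the Lipschitz estimate between the end points of the segment. -/
theorem norm_sub_le_of_finite_closed_cover {E F ι : Type*} [NormedAddCommGroup E]
    [NormedSpace ℝ E] [NormedAddCommGroup F] {s : Set ι} (hs : s.Finite) {R : ι → Set E}
    (hR : ∀ i ∈ s, IsClosed (R i)) {f : E → F} {C : ℝ} (hC : 0 ≤ C)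
    (hf : ∀ i ∈ s, ∀ x ∈ R i, ∀ y ∈ R i, ‖f x - f y‖ ≤ C * ‖x - y‖) {x y : E}
    (hcov : ∀ z ∈ segment ℝ x y, ∃ i ∈ s, z ∈ R i) : ‖f y - f x‖ ≤ C * ‖y - x‖ := by
  let z : ℝ → E := fun t => x + t • (y - x)
  have hz : Continuous z := by fun_prop
  have hzcov : ∀ t ∈ Set.Icc (0 : ℝ) 1, ∃ i ∈ s, z t ∈ R i := fun t ht =>
    hcov _ (by rw [segment_eq_image']; exact ⟨t, ht, rfl⟩)
  let S : Set ℝ := {t | ‖f (z t) - f x‖ ≤ C * (t * ‖y - x‖)}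
  -- Continuity of `f` is known only on each piece, so closedness is checked piece by piece.
  have hclosed : IsClosed (S ∩ Set.Icc 0 1) := by
    have heq : S ∩ Set.Icc 0 1 = ⋃ i ∈ s, (z ⁻¹' R i ∩ Set.Icc 0 1) ∩
        (fun t => ‖f (z t) - f x‖ - C * (t * ‖y - x‖)) ⁻¹' Set.Iic 0 := by
      ext t
      simp only [Set.mem_inter_iff, Set.mem_iUnion, Set.mem_preimage, Set.mem_Iic, sub_nonpos, S,
        Set.mem_ofPred_eq]
      constructor
      · rintro ⟨h1, h2⟩
        obtain ⟨i, hi, hti⟩ := hzcov t h2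
        exact ⟨i, hi, ⟨hti, h2⟩, h1⟩
      · rintro ⟨i, hi, ⟨-, h2⟩, h1⟩
        exact ⟨h1, h2⟩
    rw [heq]
    refine hs.isClosed_biUnion fun i hi => ?_
    have hfi : ContinuousOn f (R i) :=
      (LipschitzOnWith.of_dist_le_mul (K := ⟨C, hC⟩) fun a ha b hb => by
        rw [dist_eq_norm, dist_eq_norm]; exact hf i hi a ha b hb).continuousOn
    refine ContinuousOn.preimage_isClosed_of_isClosed ?_
      (((hR i hi).preimage hz).inter isClosed_Icc) isClosed_Iic
    refine ContinuousOn.sub (ContinuousOn.norm (ContinuousOn.sub ?_ continuousOn_const))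
      (by fun_prop)
    exact hfi.comp hz.continuousOn fun t ht => ht.1
  have hall := hclosed.Icc_subset_of_forall_exists_gt (by simp [S, z]) (by
    rintro t ⟨htS, ht⟩ u hu
    -- Close to `t`, only pieces containing `z t` can be met, as the others are closed and miss it.
    -- Hence `z t` and a slightly later point share a piece, and the estimate extends past `t`.
    have hev : ∀ᶠ t' in nhdsWithin t (Set.Ioi t), ∀ i ∈ s, z t' ∈ R i → z t ∈ R i := by
      rw [Filter.eventually_all_finite hs]
      intro i hi
      by_cases hti : z t ∈ R i
      · exact Filter.Eventually.of_forall fun _ _ => hti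
      · have := (((hR i hi).preimage hz).isOpen_compl.mem_nhds hti)
        filter_upwards [nhdsWithin_le_nhds this] with t' ht' h
        exact absurd h ht'
    have hu' : Set.Ioc t (min u 1) ∈ nhdsWithin t (Set.Ioi t) :=
      Ioc_mem_nhdsGT (lt_min hu ht.2)
    obtain ⟨t', h1, h2⟩ := (hev.and hu').exists
    obtain ⟨i, hi, hi'⟩ := hzcov t' ⟨ht.1.trans h2.1.le, h2.2.trans (min_le_right _ _)⟩
    refine ⟨t', ?_, h2.1, h2.2.trans (min_le_left _ _)⟩
    have hstep := hf i hi _ hi' _ (h1 i hi hi')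
    have hzz : z t' - z t = (t' - t) • (y - x) := by
      simp only [z, sub_smul]
      abel
    rw [hzz, norm_smul, Real.norm_of_nonneg (sub_nonneg.2 h2.1.le)] at hstep
    have htS' : ‖f (z t) - f x‖ ≤ C * (t * ‖y - x‖) := htS
    change ‖f (z t') - f x‖ ≤ C * (t' * ‖y - x‖)
    calc ‖f (z t') - f x‖ ≤ ‖f (z t') - f (z t)‖ + ‖f (z t) - f x‖ :=
        norm_sub_le_norm_sub_add_norm_sub _ _ _
      _ ≤ C * ((t' - t) * ‖y - x‖) + C * (t * ‖y - x‖) := add_le_add hstep htS'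
      _ = C * (t' * ‖y - x‖) := by ring)
  have h1 : ‖f (z 1) - f x‖ ≤ C * (1 * ‖y - x‖) := hall (Set.right_mem_Icc.2 zero_le_one)
  simpa [z] using h1

theorem exists_pos_add_smul_mem_of_mem_interior {E : Type*} [AddCommGroup E] [Module ℝ E]
    [TopologicalSpace E] [ContinuousAdd E] [ContinuousSMul ℝ E] {R : Set E} {x : E}
    (hx : x ∈ interior R) (v : E) : ∃ t : ℝ, 0 < t ∧ x + t • v ∈ R := by
  have hc : Continuous fun t : ℝ => x + t • v := by fun_prop
  have h0 : (fun t : ℝ => x + t • v) ⁻¹' R ∈ nhds (0 : ℝ) :=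
    hc.continuousAt (by simpa using mem_interior_iff_mem_nhds.1 hx)
  have := (Filter.eventually_of_mem (nhdsWithin_le_nhds h0) fun _ h => h :
    ∀ᶠ t in nhdsWithin (0 : ℝ) (Set.Ioi 0), t ∈ (fun t : ℝ => x + t • v) ⁻¹' R)
  obtain ⟨t, h1, h2⟩ := (this.and self_mem_nhdsWithin).exists
  exact ⟨t, h2, h1⟩

/-! ### Geometry of the regions -/

namespace MPC.ParametricQP

variable {n m N q : ℕ} {D : ParametricQP n m N q} {x : Fin n → ℝ}
  {lamBar rBar δ : Fin q → ℝ}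

theorem finite_setOf_isBinary : {δ : Fin q → ℝ | IsBinary δ}.Finite := by
  refine (Set.Finite.pi' (t := fun _ : Fin q => ({0, 1} : Set ℝ)) fun _ => Set.toFinite _).subset ?_
  intro δ hδ k
  simpa using hδ k

theorem convex_feasibleSet : Convex ℝ D.feasibleSet := by
  rintro x ⟨U, hU⟩ y ⟨V, hV⟩ a b ha hb hab
  refine ⟨a • U + b • V, fun k => ?_⟩
  have h1 := mul_le_mul_of_nonneg_left (hU k) ha
  have h2 := mul_le_mul_of_nonneg_left (hV k) hb
  simp only [mulVec_add, mulVec_smul, Pi.add_apply, Pi.smul_apply, smul_eq_mul] at h1 h2 ⊢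
  have h3 : D.d k = a * D.d k + b * D.d k := by rw [← add_mul, hab, one_mul]
  rw [h3]
  linarith

/-- Stationarity determines `U` from `x` and `lam`, and `lam` lies in a compact box; projecting a
closed set along a compact factor keeps it closed. -/
theorem isClosed_region (hH : D.H.PosDef) : IsClosed (D.region lamBar rBar δ) := by
  have hunit : IsUnit D.H.det := (Matrix.isUnit_iff_isUnit_det _).1 hH.isUnit
  let B : Set (Fin q → ℝ) := Set.Icc 0 fun k => lamBar k * δ k
  let W : (Fin n → ℝ) × B → Fin N × Fin m → ℝ := fun z =>
    D.H⁻¹ *ᵥ (-(D.F *ᵥ z.1 + D.Gᵀ *ᵥ (z.2 : Fin q → ℝ)))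
  have hW : Continuous W := by fun_prop
  let A : Set ((Fin n → ℝ) × B) := {z | D.E *ᵥ z.1 + D.d - D.G *ᵥ W z ∈
    Set.Icc 0 fun k => rBar k * (1 - δ k)}
  have hA : IsClosed A := isClosed_Icc.preimage (by fun_prop)
  have : CompactSpace B := isCompact_iff_compactSpace.1 isCompact_Icc
  have heq : D.region lamBar rBar δ = Prod.fst '' A := by
    ext x
    constructor
    · rintro ⟨U, lam, r, ⟨hst, rfl⟩, hr, hl⟩
      have hlB : lam ∈ B := ⟨fun k => (hl k).1, fun k => (hl k).2⟩
      have hU : W (x, ⟨lam, hlB⟩) = U := by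
        have : -(D.F *ᵥ x + D.Gᵀ *ᵥ lam) = D.H *ᵥ U := by
          rw [add_assoc] at hst
          exact (eq_neg_of_add_eq_zero_left hst).symm
        simp only [W, this, mulVec_mulVec, nonsing_inv_mul _ hunit, one_mulVec]
      refine ⟨(x, ⟨lam, hlB⟩), ?_, rfl⟩
      change _ ∈ Set.Icc _ _
      rw [hU]
      exact ⟨fun k => (hr k).1, fun k => (hr k).2⟩
    · rintro ⟨⟨x, lam⟩, hz, rfl⟩
      refine ⟨W (x, lam), lam, _, ⟨?_, rfl⟩, fun k => ⟨hz.1 k, hz.2 k⟩,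
        fun k => ⟨lam.2.1 k, lam.2.2 k⟩⟩
      simp only [W, mulVec_mulVec, mul_nonsing_inv _ hunit, one_mulVec]
      abel
  rw [heq]
  exact isClosedMap_fst_of_compactSpace A hA

/-- Thin regions can be discarded because a convex set with nonempty interior lies in the closure of
that interior. -/
theorem exists_mem_region_of_nonempty_interior (hH : D.H.PosDef)
    (hBounds : D.AreBounds lamBar rBar) (hF : (interior D.feasibleSet).Nonempty) :
    ∀ x ∈ D.feasibleSet, ∃ δ ∈ {δ | IsBinary δ},
      (interior (D.region lamBar rBar δ)).Nonempty ∧ x ∈ D.region lamBar rBar δ := by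
  refine exists_mem_of_nonempty_interior finite_setOf_isBinary
    (fun δ _ => isClosed_region hH) (fun x hx => exists_mem_region hH hBounds hx) ?_
  rw [convex_feasibleSet.closure_interior_eq_closure_of_nonempty_interior hF]
  exact subset_closure

/-- On the region of an active set the optimizer is the restriction of an affine map. -/
theorem exists_linearMap_encoding (hH : D.H.PosDef) (hδ : IsBinary δ) :
    ∃ T : (Fin n → ℝ) →ₗ[ℝ] (Fin N × Fin m → ℝ), ∀ {x y U V lam mu r s},
      D.Encoding lamBar rBar δ x U lam r → D.Encoding lamBar rBar δ y V mu s →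
      U - V = T (x - y) := by
  -- `M` contains all differences of encoding points with the same `δ`: residuals are zero where `δ
  -- k = 1`, multipliers where `δ k = 0`.
  let M : Submodule ℝ ((Fin n → ℝ) × (Fin N × Fin m → ℝ) × (Fin q → ℝ)) :=
    { carrier := {z | D.H *ᵥ z.2.1 + D.F *ᵥ z.1 + D.Gᵀ *ᵥ z.2.2 = 0 ∧
        (∀ k, δ k = 1 → (D.E *ᵥ z.1) k = (D.G *ᵥ z.2.1) k) ∧ ∀ k, δ k = 0 → z.2.2 k = 0}
      add_mem' := by
        rintro a b ⟨ha1, ha2, ha3⟩ ⟨hb1, hb2, hb3⟩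
        refine ⟨?_, fun k hk => ?_, fun k hk => ?_⟩
        · simp only [Prod.snd_add, Prod.fst_add, mulVec_add]
          rw [← add_zero (0 : Fin N × Fin m → ℝ)]
          nth_rewrite 1 [← ha1]
          rw [← hb1]
          abel
        · simp [mulVec_add, ha2 k hk, hb2 k hk]
        · simp [ha3 k hk, hb3 k hk]
      zero_mem' := by simp
      smul_mem' := by
        rintro c a ⟨ha1, ha2, ha3⟩
        refine ⟨?_, fun k hk => ?_, fun k hk => ?_⟩
        · simp only [Prod.smul_snd, Prod.smul_fst, mulVec_smul, ← smul_add, ha1, smul_zero]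
        · simp [mulVec_smul, ha2 k hk]
        · simp [ha3 k hk] }
  -- If the parameter component is zero, then `U ⬝ᵥ H U = -lam ⬝ᵥ G U = 0`, so `U = 0` whatever
  -- `lam` is. Thus `U` depends linearly on the parameter without any rank condition on `G`.
  obtain ⟨T, hT⟩ := LinearMap.exists_comp_eq_of_ker_le
    ((LinearMap.fst ℝ _ _).comp M.subtype)
    (((LinearMap.fst ℝ _ _).comp (LinearMap.snd ℝ _ _)).comp M.subtype) (by
      rintro ⟨⟨x, U, lam⟩, h1, h2, h3⟩ hx
      simp only [LinearMap.mem_ker, LinearMap.comp_apply, Submodule.subtype_apply,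
        LinearMap.fst_apply, LinearMap.snd_apply] at hx h1 h2 h3 ⊢
      subst hx
      simp only [mulVec_zero, add_zero, Pi.zero_apply] at h1 h2
      have h0 : lam ⬝ᵥ (D.G *ᵥ U) = 0 := Finset.sum_eq_zero fun k _ => by
        rcases hδ k with hk | hk
        · rw [h3 k hk, zero_mul]
        · rw [← h2 k hk, mul_zero]
      have h4 : U ⬝ᵥ (D.H *ᵥ U) = 0 := by
        rw [eq_neg_of_add_eq_zero_left h1, dotProduct_neg, dotProduct_comm, mulVec_transpose,
          ← dotProduct_mulVec, h0, neg_zero]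
      by_contra hU
      have := hH.dotProduct_mulVec_pos hU
      simp [h4] at this)
  refine ⟨T, fun {x y U V lam mu r s} h1 h2 => ?_⟩
  have hmem : (x - y, U - V, lam - mu) ∈ M := by
    obtain ⟨⟨hs1, rfl⟩, hr1, hl1⟩ := h1
    obtain ⟨⟨hs2, rfl⟩, hr2, hl2⟩ := h2
    refine ⟨?_, fun k hk => ?_, fun k hk => ?_⟩
    · simp only [mulVec_sub]
      rw [← sub_zero (0 : Fin N × Fin m → ℝ)]
      nth_rewrite 1 [← hs1]
      rw [← hs2]
      abel
    · have a1 := hr1 k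
      have a2 := hr2 k
      rw [hk] at a1 a2
      simp only [mulVec_sub, Pi.sub_apply, Pi.add_apply] at a1 a2 ⊢
      linarith
    · have a1 := hl1 k
      have a2 := hl2 k
      rw [hk] at a1 a2
      simp only [Pi.sub_apply]
      linarith
  exact (hT ⟨_, hmem⟩).symm

/-! ### Local gains, Lipschitz constants and the MILP -/

variable [NeZero N]

theorem exists_isGainOn_region (hH : D.H.PosDef) (hδ : IsBinary δ) :
    ∃ K, D.IsGainOn (D.region lamBar rBar δ) K := by
  obtain ⟨T, hT⟩ := exists_linearMap_encoding (lamBar := lamBar) (rBar := rBar) hH hδ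
  refine ⟨LinearMap.toMatrix' ((LinearMap.funLeft ℝ ℝ fun j => ((0 : Fin N), j)).comp T), ?_⟩
  rcases (D.region lamBar rBar δ).eq_empty_or_nonempty with he | ⟨y, V, mu, s, hy⟩
  · exact ⟨0, by simp [he]⟩
  · refine ⟨fun j => V (0, j) - T y (0, j), ?_⟩
    rintro x ⟨U, lam, r, hx⟩
    ext j
    have := congrFun (hT hx hy) (0, j)
    simp only [map_sub, Pi.sub_apply] at this
    rw [hx.controlLaw_eq hH hδ, LinearMap.toMatrix'_mulVec]
    simp only [LinearMap.comp_apply, LinearMap.funLeft_apply, Pi.add_apply]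
    linarith

theorem IsGainOn.eq {R : Set (Fin n → ℝ)} {K K' : Matrix (Fin m) (Fin n) ℝ}
    (hR : (interior R).Nonempty) (h : D.IsGainOn R K) (h' : D.IsGainOn R K') : K = K' := by
  obtain ⟨b, hb⟩ := h
  obtain ⟨b', hb'⟩ := h'
  obtain ⟨x, hx⟩ := hR
  refine Matrix.ext_of_mulVec_single fun j => ?_
  obtain ⟨t, ht, htv⟩ := exists_pos_add_smul_mem_of_mem_interior hx (Pi.single j (1 : ℝ))
  have h1 := (hb _ htv).symm.trans (hb' _ htv)
  have h2 := (hb _ (interior_subset hx)).symm.trans (hb' _ (interior_subset hx))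
  rw [mulVec_add, mulVec_add, mulVec_smul, mulVec_smul] at h1
  have h3 : t • (K *ᵥ Pi.single j 1) = t • (K' *ᵥ Pi.single j 1) := by
    have e : ∀ a c d : Fin m → ℝ, a = (c + a + d) - (c + d) := fun a c d => by abel
    rw [e (t • (K *ᵥ Pi.single j 1)) (K *ᵥ x) b, h1, h2, ← e]
  exact smul_right_injective _ ht.ne' h3

theorem norm_mulVec_le_inducedNorm (p : ℝ≥0∞) [Fact (1 ≤ p)] (K : Matrix (Fin m) (Fin n) ℝ)
    (v : Fin n → ℝ) :
    ‖WithLp.toLp p (K *ᵥ v)‖ ≤ inducedNorm p K * ‖WithLp.toLp p v‖ :=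
  (LinearMap.toContinuousLinearMap (Matrix.toLpLin p p K)).le_opNorm (WithLp.toLp p v)

/-- From an interior point every direction can be tested by a short step, whose length cancels. -/
theorem inducedNorm_le_of_mem_lipschitzConstants {p : ℝ≥0∞} [Fact (1 ≤ p)] {L : ℝ}
    {R : Set (Fin n → ℝ)} {K : Matrix (Fin m) (Fin n) ℝ} (hL : L ∈ D.lipschitzConstants p)
    (hsub : R ⊆ D.feasibleSet) (hR : (interior R).Nonempty) (hK : D.IsGainOn R K) :
    inducedNorm p K ≤ L := by
  obtain ⟨b, hb⟩ := hK
  obtain ⟨x, hx⟩ := hR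
  refine ContinuousLinearMap.opNorm_le_bound _ hL.1 fun v => ?_
  obtain ⟨t, ht, htv⟩ := exists_pos_add_smul_mem_of_mem_interior hx (WithLp.ofLp v)
  have h := hL.2 _ (hsub htv) _ (hsub (interior_subset hx))
  rw [hb _ htv, hb _ (interior_subset hx), add_sub_add_right_eq_sub, ← mulVec_sub,
    add_sub_cancel_left, mulVec_smul, WithLp.toLp_smul, WithLp.toLp_smul, norm_smul, norm_smul,
    Real.norm_of_nonneg ht.le, mul_left_comm] at h
  exact le_of_mul_le_mul_left h ht

/-- Convexity keeps segments feasible, and full-dimensional regions cover them, so bounds on each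
region pass to the whole feasible set. -/
theorem mem_lipschitzConstants {p : ℝ≥0∞} [Fact (1 ≤ p)] {L : ℝ} (hH : D.H.PosDef)
    (hBounds : D.AreBounds lamBar rBar) (hF : (interior D.feasibleSet).Nonempty) (hL : 0 ≤ L)
    (h : L ∈ upperBounds (D.gainNorms lamBar rBar p fun _ => True)) :
    L ∈ D.lipschitzConstants p := by
  refine ⟨hL, fun x hx y hy => ?_⟩
  set s := {δ : Fin q → ℝ | IsBinary δ ∧ (interior (D.region lamBar rBar δ)).Nonempty}
  have hs : s.Finite := finite_setOf_isBinary.subset fun δ hδ => hδ.1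
  refine norm_sub_le_of_finite_closed_cover (E := WithLp p (Fin n → ℝ))
    (F := WithLp p (Fin m → ℝ)) (f := fun z => WithLp.toLp p (D.controlLaw (WithLp.ofLp z)))
    (R := fun δ => WithLp.ofLp ⁻¹' D.region lamBar rBar δ) hs
    (fun δ _ => (isClosed_region hH).preimage (PiLp.continuous_ofLp p _)) hL ?_
    (x := WithLp.toLp p y) (y := WithLp.toLp p x) ?_
  · intro δ hδ x hx y hy
    obtain ⟨K, hK⟩ := exists_isGainOn_region (lamBar := lamBar) (rBar := rBar) hH hδ.1
    have hKL : inducedNorm p K ≤ L := h ⟨δ, K, hδ.1, trivial, hδ.2, hK, rfl⟩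
    obtain ⟨b, hb⟩ := hK
    rw [hb _ hx, hb _ hy, ← WithLp.toLp_sub, add_sub_add_right_eq_sub, ← mulVec_sub]
    exact (norm_mulVec_le_inducedNorm p K _).trans
      (mul_le_mul_of_nonneg_right hKL (norm_nonneg _))
  · rintro _ ⟨a, b, ha, hb, hab, rfl⟩
    obtain ⟨δ, hδ, hint, hmem⟩ := exists_mem_region_of_nonempty_interior hH hBounds hF _
      (convex_feasibleSet hy hx ha hb hab)
    exact ⟨δ, ⟨hδ, hint⟩, hmem⟩

/-- If the MILP has optimal value `0`, the control law is constant on every region in which the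
constraint `i` is active. -/
theorem controlLaw_eq_of_milpValues_nonpos {i : Fin q} (hH : D.H.PosDef)
    (h : 0 ∈ upperBounds (D.milpValues lamBar rBar i)) (hδ : IsBinary δ) (hi : δ i = 1)
    {x y : Fin n → ℝ} (hx : x ∈ D.region lamBar rBar δ) (hy : y ∈ D.region lamBar rBar δ) :
    D.controlLaw x = D.controlLaw y := by
  classical
  have key : ∀ x ∈ D.region lamBar rBar δ, ∀ y ∈ D.region lamBar rBar δ,
      D.controlLaw y ≤ D.controlLaw x := by
    rintro x ⟨U, lam, r, hx⟩ y ⟨V, mu, s, hy⟩ j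
    -- Every copy except the `j`-th repeats the base point, so the objective reduces to the
    -- difference in coordinate `j`; swapping `x` and `y` gives the reverse inequality.
    have hle := h ⟨δ, x, U, lam, r, fun l => if l = j then y else x,
      fun l => if l = j then V else U, fun l => if l = j then mu else lam,
      fun l => if l = j then s else r, hδ, hi, hx, fun l => by
        by_cases hl : l = j
        · simpa [hl] using hy
        · simpa [hl] using hx, rfl⟩
    rw [Finset.sum_eq_single j (fun l _ hl => by simp [hl]) (by simp)] at hle
    simp only [if_true, sub_nonpos] at hle
    rwa [hx.controlLaw_eq hH hδ, hy.controlLaw_eq hH hδ]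
  exact le_antisymm (key y hy x hx) (key x hx y hy)

theorem isGainOn_region_iff_eq_zero {i : Fin q} {K : Matrix (Fin m) (Fin n) ℝ} (hH : D.H.PosDef)
    (h : 0 ∈ upperBounds (D.milpValues lamBar rBar i)) (hδ : IsBinary δ) (hi : δ i = 1)
    (hint : (interior (D.region lamBar rBar δ)).Nonempty) :
    D.IsGainOn (D.region lamBar rBar δ) K ↔ K = 0 := by
  have h0 : D.IsGainOn (D.region lamBar rBar δ) 0 := by
    obtain ⟨y, hy⟩ := hint
    refine ⟨D.controlLaw y, fun x hx => ?_⟩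
    rw [zero_mulVec, zero_add]
    exact controlLaw_eq_of_milpValues_nonpos hH h hδ hi hx (interior_subset hy)
  exact ⟨fun hK => hK.eq hint h0, fun hK => hK ▸ h0⟩

theorem exists_isGreatest_gainNorms {p : ℝ≥0∞} [Fact (1 ≤ p)] (hH : D.H.PosDef)
    (hBounds : D.AreBounds lamBar rBar) (hF : (interior D.feasibleSet).Nonempty) :
    ∃ L, IsGreatest (D.gainNorms lamBar rBar p fun _ => True) L := by
  set s := {δ : Fin q → ℝ | IsBinary δ ∧ (interior (D.region lamBar rBar δ)).Nonempty}
  have hs : s.Finite := finite_setOf_isBinary.subset fun δ hδ => hδ.1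
  have hne : s.Nonempty := by
    obtain ⟨x, hx⟩ := hF
    obtain ⟨δ, hδ, hint, -⟩ := exists_mem_region_of_nonempty_interior hH hBounds ⟨x, hx⟩ x
      (interior_subset hx)
    exact ⟨δ, hδ, hint⟩
  have hgain : ∀ δ, ∃ K, δ ∈ s → D.IsGainOn (D.region lamBar rBar δ) K := fun δ => by
    by_cases hδ : δ ∈ s
    · exact (exists_isGainOn_region hH hδ.1).imp fun K hK _ => hK
    · exact ⟨0, fun h => absurd h hδ⟩
  choose K hK using hgain
  obtain ⟨δ, hδ, hmax⟩ := Set.exists_max_image s (fun δ => inducedNorm p (K δ)) hs hne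
  refine ⟨inducedNorm p (K δ), ⟨δ, K δ, hδ.1, trivial, hδ.2, hK δ hδ, rfl⟩, ?_⟩
  rintro _ ⟨η, K', hη, -, hint, hK', rfl⟩
  rw [hK'.eq hint (hK η ⟨hη, hint⟩)]
  exact hmax η ⟨hη, hint⟩

end MPC.ParametricQP

theorem theorem1 {n m N q : ℕ} [NeZero N] (D : MPC.ParametricQP n m N q) (hH : D.H.PosDef)
    (lamBar rBar : Fin q → ℝ) (hBounds : D.AreBounds lamBar rBar)
    (hF : (interior D.feasibleSet).Nonempty) (i : Fin q)
    (hMILP : IsGreatest (D.milpValues lamBar rBar i) 0) :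
    (∀ δ : Fin q → ℝ, MPC.ParametricQP.IsBinary δ → δ i = 1 →
      (∀ K, D.IsGainOn (D.region lamBar rBar δ) K ↔ K = 0) ∨
        ¬ (interior (D.region lamBar rBar δ)).Nonempty) ∧
    ∀ (p : ENNReal) [Fact (1 ≤ p)], ∃ L : ℝ,
      IsLeast (D.lipschitzConstants p) L ∧
      IsGreatest (D.gainNorms lamBar rBar p fun _ => True) L ∧
      IsGreatest (insert 0 (D.gainNorms lamBar rBar p fun δ => δ i = 0)) L := by
  refine ⟨fun δ hδ hi => ?_, fun p _ => ?_⟩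
  · by_cases hint : (interior (D.region lamBar rBar δ)).Nonempty
    · exact Or.inl fun K =>
        MPC.ParametricQP.isGainOn_region_iff_eq_zero hH hMILP.2 hδ hi hint
    · exact Or.inr hint
  · obtain ⟨L, hL⟩ :=
      MPC.ParametricQP.exists_isGreatest_gainNorms (p := p) hH hBounds hF
    obtain ⟨δ, K, hδ, -, hint, hK, hLK⟩ := hL.1
    have hL0 : 0 ≤ L := hLK ▸ norm_nonneg _
    refine ⟨L, ⟨MPC.ParametricQP.mem_lipschitzConstants hH hBounds hF hL0 hL.2,
      fun L' hL' => ?_⟩, hL, ?_, ?_⟩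
    · rw [hLK]
      exact MPC.ParametricQP.inducedNorm_le_of_mem_lipschitzConstants hL'
        (MPC.ParametricQP.region_subset_feasibleSet hδ) hint hK
    · rcases hδ i with hi | hi
      · exact Or.inr ⟨δ, K, hδ, hi, hint, hK, hLK⟩
      -- If the maximum is attained with `δ i = 1`, the gain is zero, so `L` is the inserted `0`.
      · left
        rw [(MPC.ParametricQP.isGainOn_region_iff_eq_zero hH hMILP.2 hδ hi hint).1 hK] at hLK
        simpa [MPC.ParametricQP.inducedNorm] using hLK
    · rintro c (rfl | ⟨η, K', hη, -, h⟩)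
      · exact hL0
      · exact hL.2 ⟨η, K', hη, trivial, h⟩
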